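/- For a sequence $(a_n)_{n\ge1}$ of positive integers write $[0;a_1,a_2,\dots]=\lim_{n\to\infty}[0;a_1,\dots,a_n]$, where $[0;a_1,\dots,a_n]=\cfrac{1}{a_1+\cfrac{1}{a_2+\cfrac{1}{\cdots+\cfrac{1}{a_n}}}}$, and let $$E_4=\bigl\{[0;a_1,a_2,\dots] : a_n\in\{1,2,3,4\}\text{ for all } n\ge 1\bigr\}\subset[0,1].$$ Then the Hausdorff dimension of $E_4$ satisfies $\dim_H(E_4)=0.788945557483\pm10^{-12}$, that is, $$0.788945557483-10^{-12}\;\le\;\dim_H(E_4)\;\le\;0.788945557483+10^{-12}.$$ In particular $\dim_H(E_4)>\dfrac{\sqrt{19}-2}{3}$. -/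

import Mathlib

open Filter Topology

/-- The infinite continued fraction expression `[0; a 0, a 1, a 2, …]`, that is
`1 / (a 0 + 1 / (a 1 + 1 / (a 2 + ⋯)))`, over the reals. -/
def digitContFract (a : ℕ → ℕ) : GenContFract ℝ where
  h := 0
  s := ⟨fun n => some ⟨1, (a n : ℝ)⟩, fun {_} h => by simp at h⟩

/-- `x = [0; a 0, a 1, …]`: the finite continued fractions `[0; a 0, …, a (n - 1)]`
(evaluated as nested fractions) converge to `x`. -/
def IsContFractValue (a : ℕ → ℕ) (x : ℝ) : Prop :=
  Tendsto (fun n => (digitContFract a).convs' n) atTop (𝓝 x)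

/-- `E m`: the reals `[0; a 0, a 1, a 2, …]` given by infinite continued fractions all of whose
digits lie in `{1, 2, …, m}`. -/
def contFractSet (m : ℕ) : Set ℝ :=
  {x | ∃ a : ℕ → ℕ, (∀ n, a n ∈ Finset.Icc 1 m) ∧ IsContFractValue a x}

/-! `contFractSet 4` is the limit set of the four branches `x ↦ 1/(d + x)`, and its dimension is the
`s` at which the transfer operator `L_s` has leading eigenvalue 1. No spectral theory is needed,
since a positive test function `f` suffices. If `L_s f ≤ f` on an interval mapped into itself, the
iterates stay bounded, so the sums of (diameter)^s over the cylinders of length `n` are bounded and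
the Hausdorff measure is finite (`dimH_contFractSet_four_le`). If `L_s f ≥ f`, the iterates
increase; bounded distortion, separation of cylinders and compactness of the sequence space then
bound every cover from below (`le_dimH_contFractSet_four`).

One explicit polynomial `f` of degree 20 serves both bounds: at `s = dimApprox` it satisfies `|L_s f
- f| ≤ 10⁻¹³ f` (`abs_transferOp_eigFun_sub_le`). Raising `s` by `δ` shrinks `L_s f` by at least the
factor `(36/25)^δ` (`transferOp_add_mul_le`), so moving `s` by about `10⁻¹²` either way beats the
error and gives the two strict-sign inequalities. The estimate itself is reduced to integer
polynomial arithmetic decided by the kernel; the irrational powers `(d + x)^(-2s)` enter only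
through their differential equation. -/

/-! ### Inverse branches, words and bounded distortion -/

/-- The digit `i + 1 ∈ {1, 2, 3, 4}` as a real number. -/
noncomputable def digitVal (i : Fin 4) : ℝ := (i : ℕ) + 1

/-- The composition of the inverse branches `x ↦ 1 / (i + x)` along a word. -/
noncomputable def wordMap : List (Fin 4) → ℝ → ℝ
  | [], x => x
  | i :: w, x => 1 / (digitVal i + wordMap w x)

/-- The absolute value of the derivative of `wordMap w`. -/
noncomputable def wordDer : List (Fin 4) → ℝ → ℝ
  | [], _ => 1
  | i :: w, x => wordDer w x / (digitVal i + wordMap w x) ^ 2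

/-- An interval that is mapped into itself by all the branches. -/
def coreInterval : Set ℝ := Set.Icc (1 / 5) (5 / 6)

theorem one_le_digitVal (i : Fin 4) : 1 ≤ digitVal i := by
  simp [digitVal]

theorem digitVal_le (i : Fin 4) : digitVal i ≤ 4 := by
  have h : (i : ℕ) ≤ 3 := by omega
  have : ((i : ℕ) : ℝ) ≤ 3 := by exact_mod_cast h
  simp only [digitVal]; linarith

theorem wordMap_nonneg (w : List (Fin 4)) {x : ℝ} (hx : 0 ≤ x) : 0 ≤ wordMap w x := by
  induction w with
  | nil => exact hx
  | cons i w ih =>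
    have := one_le_digitVal i
    simp only [wordMap]; positivity

theorem branch_le_one (i : Fin 4) {x : ℝ} (hx : 0 ≤ x) : 1 / (digitVal i + x) ≤ 1 := by
  have := one_le_digitVal i
  rw [div_le_one (by linarith)]; linarith

theorem branch_mem_coreInterval (i : Fin 4) {x : ℝ} (hx : x ∈ coreInterval) :
    1 / (digitVal i + x) ∈ coreInterval := by
  obtain ⟨h1, h2⟩ := hx
  have := one_le_digitVal i
  have := digitVal_le i
  constructor
  · exact one_div_le_one_div_of_le (by linarith) (by linarith)
  · rw [div_le_div_iff₀ (by linarith) (by norm_num)]; linarith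

theorem coreInterval_nonneg {x : ℝ} (hx : x ∈ coreInterval) : 0 ≤ x :=
  le_trans (by norm_num) hx.1

theorem coreInterval_le_one {x : ℝ} (hx : x ∈ coreInterval) : x ≤ 1 :=
  hx.2.trans (by norm_num)

theorem half_mem_coreInterval : (1 / 2 : ℝ) ∈ coreInterval := by
  constructor <;> norm_num

theorem wordMap_mem_coreInterval (w : List (Fin 4)) {x : ℝ} (hx : x ∈ coreInterval) :
    wordMap w x ∈ coreInterval := by
  induction w with
  | nil => exact hx
  | cons i w ih => exact branch_mem_coreInterval i ih

theorem wordMap_le_one (w : List (Fin 4)) {x : ℝ} (hx : 0 ≤ x) (hx1 : x ≤ 1) :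
    wordMap w x ≤ 1 := by
  cases w with
  | nil => exact hx1
  | cons i w => exact branch_le_one i (wordMap_nonneg w hx)

theorem wordMap_append (u v : List (Fin 4)) (x : ℝ) :
    wordMap (u ++ v) x = wordMap u (wordMap v x) := by
  induction u with
  | nil => rfl
  | cons i u ih => simp only [List.cons_append, wordMap, ih]

theorem wordDer_append (u v : List (Fin 4)) (x : ℝ) :
    wordDer (u ++ v) x = wordDer u (wordMap v x) * wordDer v x := by
  induction u with
  | nil => simp [wordDer]
  | cons i u ih => simp only [List.cons_append, wordDer, ih, wordMap_append]; ring

theorem wordDer_pos (w : List (Fin 4)) {x : ℝ} (hx : 0 ≤ x) : 0 < wordDer w x := by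
  induction w with
  | nil => exact one_pos
  | cons i w ih =>
    have := one_le_digitVal i
    have := wordMap_nonneg w hx
    simp only [wordDer]; positivity

/-- An exact mean value identity for Möbius maps. It bounds cylinder diameters from above and,
later, distances between coded points from below. -/
theorem sq_wordMap_sub (w : List (Fin 4)) {x y : ℝ} (hx : 0 ≤ x) (hy : 0 ≤ y) :
    (wordMap w x - wordMap w y) ^ 2 = (x - y) ^ 2 * (wordDer w x * wordDer w y) := by
  induction w with
  | nil => simp [wordMap, wordDer]
  | cons i w ih =>
    have := one_le_digitVal i
    have := wordMap_nonneg w hx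
    have := wordMap_nonneg w hy
    have h1 : digitVal i + wordMap w x ≠ 0 := by positivity
    have h2 : digitVal i + wordMap w y ≠ 0 := by positivity
    have : (wordMap (i :: w) x - wordMap (i :: w) y) ^ 2 = (wordMap w x - wordMap w y) ^ 2 /
        ((digitVal i + wordMap w x) ^ 2 * (digitVal i + wordMap w y) ^ 2) := by
      simp only [wordMap]; field_simp; ring
    rw [this, ih]
    simp only [wordDer]; field_simp

/-- The map is Möbius of determinant ±1 with denominator `q + r * x`. Appending a letter on the
right acts on the pair of continuants by `(q, r) ↦ (q * d + r, q)`, hence the reverse induction. -/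
theorem exists_wordDer_eq (w : List (Fin 4)) : ∃ q r : ℝ, 0 < q ∧ 0 ≤ r ∧ r ≤ q ∧
    ∀ x, 0 ≤ x → wordDer w x = 1 / (q + r * x) ^ 2 := by
  induction w using List.reverseRecOn with
  | nil => exact ⟨1, 0, one_pos, le_rfl, zero_le_one, fun x _ => by simp [wordDer]⟩
  | append_singleton w i ih =>
    obtain ⟨q, r, hq, hr, hrq, h⟩ := ih
    have hi := one_le_digitVal i
    refine ⟨q * digitVal i + r, q, by positivity, hq.le, by nlinarith, fun x hx => ?_⟩
    have h0 : 0 < digitVal i + x := by linarith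
    rw [wordDer_append]
    simp only [wordDer, wordMap]
    rw [h _ (by positivity)]
    have : q + r * (1 / (digitVal i + x)) = (q * digitVal i + r + q * x) / (digitVal i + x) := by
      field_simp; ring
    rw [this]
    field_simp

/-- Bounded distortion. -/
theorem wordDer_le_four_mul (w : List (Fin 4)) {x y : ℝ} (hx : 0 ≤ x) (hy : 0 ≤ y) (hy1 : y ≤ 1) :
    wordDer w x ≤ 4 * wordDer w y := by
  obtain ⟨q, r, hq, hr, hrq, h⟩ := exists_wordDer_eq w
  rw [h x hx, h y hy, mul_one_div, div_le_div_iff₀ (by positivity) (by positivity)]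
  -- As `r ≤ q` and `y ≤ 1`, denominators differ by a factor of at most 2; squaring gives 4.
  have h1 : q + r * y ≤ 2 * (q + r * x) := by nlinarith [mul_nonneg hr hx]
  have h2 : 0 ≤ q + r * y := by positivity
  nlinarith

/-- On `coreInterval` each denominator is at least `1 + 1/5`, whose square is `36/25`. At 0 the
branch `1/(1 + x)` has derivative of modulus 1, so `[0, 1]` would give no uniform rate. -/
theorem wordDer_le_pow (w : List (Fin 4)) {x : ℝ} (hx : x ∈ coreInterval) :
    wordDer w x ≤ (25 / 36) ^ w.length := by
  induction w with
  | nil => simp [wordDer]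
  | cons i w ih =>
    have := one_le_digitVal i
    have h := (wordMap_mem_coreInterval w hx).1
    simp only [wordDer, List.length_cons, pow_succ]
    rw [div_le_iff₀ (by positivity)]
    have : (36 / 25 : ℝ) ≤ (digitVal i + wordMap w x) ^ 2 := by nlinarith
    have h0 : (0 : ℝ) < (25 / 36) ^ w.length := by positivity
    nlinarith

theorem abs_wordMap_sub_le (w : List (Fin 4)) {x y z : ℝ} (hx : x ∈ Set.Icc (0 : ℝ) 1)
    (hy : y ∈ Set.Icc (0 : ℝ) 1) (hz : z ∈ Set.Icc (0 : ℝ) 1) :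
    |wordMap w x - wordMap w y| ≤ 4 * wordDer w z := by
  have h0 := wordDer_pos w hz.1
  refine abs_le_of_sq_le_sq ?_ (by positivity)
  rw [sq_wordMap_sub w hx.1 hy.1]
  have h1 := wordDer_le_four_mul w hx.1 hz.1 hz.2
  have h2 := wordDer_le_four_mul w hy.1 hz.1 hz.2
  have h3 := wordDer_pos w hx.1
  have h4 := wordDer_pos w hy.1
  have h5 : (x - y) ^ 2 ≤ 1 := by
    rw [sq_le_one_iff_abs_le_one, abs_le]
    constructor <;> linarith [hx.1, hx.2, hy.1, hy.2]
  calc (x - y) ^ 2 * (wordDer w x * wordDer w y) ≤ 1 * ((4 * wordDer w z) * (4 * wordDer w z)) := by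
        gcongr
    _ = _ := by ring

/-! ### Coding of the set by sequences of letters -/

/-- The first `n` letters of a sequence. -/
def prefixWord : (ℕ → Fin 4) → ℕ → List (Fin 4)
  | _, 0 => []
  | b, n + 1 => b 0 :: prefixWord (fun k => b (k + 1)) n

theorem length_prefixWord (b : ℕ → Fin 4) (n : ℕ) : (prefixWord b n).length = n := by
  induction n generalizing b with
  | zero => rfl
  | succ n ih => simp [prefixWord, ih]

theorem prefixWord_add (b : ℕ → Fin 4) (n m : ℕ) :
    prefixWord b (n + m) = prefixWord b n ++ prefixWord (fun k => b (k + n)) m := by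
  induction n generalizing b with
  | zero => simp [prefixWord]
  | succ n ih =>
    rw [Nat.succ_add_eq_add_succ, Nat.add_succ]
    simp only [prefixWord, ih, List.cons_append]
    simp only [Nat.add_assoc]

theorem prefixWord_congr {a b : ℕ → Fin 4} {n : ℕ} (h : ∀ k < n, a k = b k) :
    prefixWord a n = prefixWord b n := by
  induction n generalizing a b with
  | zero => rfl
  | succ n ih =>
    simp only [prefixWord]
    rw [h 0 (by omega), ih fun k hk => h (k + 1) (by omega)]

theorem exists_tendsto_wordMap (b : ℕ → Fin 4) :
    ∃ x, Tendsto (fun n => wordMap (prefixWord b n) 0) atTop (𝓝 x) := by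
  refine cauchySeq_tendsto_of_complete (cauchySeq_of_le_geometric (25 / 36) 4 (by norm_num) ?_)
  intro n
  rw [prefixWord_add b n 1, wordMap_append, Real.dist_eq]
  -- The base point 0 lies outside `coreInterval`; distortion transfers the rate from `1/2`.
  refine (abs_wordMap_sub_le _ ⟨le_rfl, zero_le_one⟩
    ⟨wordMap_nonneg _ le_rfl, wordMap_le_one _ le_rfl zero_le_one⟩
    (z := 1 / 2) ⟨by norm_num, by norm_num⟩).trans ?_
  have := wordDer_le_pow (prefixWord b n) half_mem_coreInterval
  rw [length_prefixWord] at this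
  linarith

/-- The value of the continued fraction coded by a sequence of letters. -/
noncomputable def cfValue (b : ℕ → Fin 4) : ℝ := (exists_tendsto_wordMap b).choose

theorem tendsto_cfValue (b : ℕ → Fin 4) :
    Tendsto (fun n => wordMap (prefixWord b n) 0) atTop (𝓝 (cfValue b)) :=
  (exists_tendsto_wordMap b).choose_spec

theorem cfValue_nonneg (b : ℕ → Fin 4) : 0 ≤ cfValue b :=
  ge_of_tendsto' (tendsto_cfValue b) fun _ => wordMap_nonneg _ le_rfl

theorem cfValue_eq_branch (b : ℕ → Fin 4) :
    cfValue b = 1 / (digitVal (b 0) + cfValue fun k => b (k + 1)) := by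
  have h1 := (tendsto_add_atTop_iff_nat 1).2 (tendsto_cfValue b)
  refine tendsto_nhds_unique h1 ?_
  have h2 := tendsto_cfValue fun k => b (k + 1)
  have := one_le_digitVal (b 0)
  have := cfValue_nonneg fun k => b (k + 1)
  exact tendsto_const_nhds.div (h2.const_add (digitVal (b 0))) (by positivity)

theorem cfValue_mem_coreInterval (b : ℕ → Fin 4) : cfValue b ∈ coreInterval := by
  have h : ∀ b, cfValue b ≤ 1 := fun b => by
    rw [cfValue_eq_branch]; exact branch_le_one _ (cfValue_nonneg _)
  have h5 : ∀ b, 1 / 5 ≤ cfValue b := fun b => by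
    rw [cfValue_eq_branch]
    have := one_le_digitVal (b 0)
    have := digitVal_le (b 0)
    have := cfValue_nonneg fun k => b (k + 1)
    exact one_div_le_one_div_of_le (by positivity) (by linarith [h fun k => b (k + 1)])
  refine ⟨h5 b, ?_⟩
  rw [cfValue_eq_branch]
  have := one_le_digitVal (b 0)
  have := h5 fun k => b (k + 1)
  rw [div_le_div_iff₀ (by linarith) (by norm_num)]; linarith

theorem cfValue_eq_wordMap (b : ℕ → Fin 4) (n : ℕ) :
    cfValue b = wordMap (prefixWord b n) (cfValue fun k => b (k + n)) := by
  induction n generalizing b with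
  | zero => rfl
  | succ n ih =>
    rw [cfValue_eq_branch, ih]
    simp only [prefixWord, wordMap, Nat.add_assoc]

theorem convs'Aux_digitContFract (a : ℕ → ℕ) (b : ℕ → Fin 4) (h : ∀ n, a n = b n + 1) (n : ℕ) :
    GenContFract.convs'Aux (digitContFract a).s n = wordMap (prefixWord b n) 0 := by
  induction n generalizing a b with
  | zero => rfl
  | succ n ih =>
    have := ih (fun k => a (k + 1)) (fun k => b (k + 1)) fun k => h (k + 1)
    simp only [prefixWord, wordMap, ← this]
    have h0 : digitVal (b 0) = (a 0 : ℝ) := by simp [digitVal, h 0]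
    rw [h0]
    rfl

theorem contFractSet_four : contFractSet 4 = Set.range cfValue := by
  have key : ∀ (a : ℕ → ℕ) (b : ℕ → Fin 4), (∀ n, a n = b n + 1) →
      IsContFractValue a (cfValue b) := fun a b h => by
    refine (tendsto_cfValue b).congr fun n => ?_
    rw [← convs'Aux_digitContFract a b h, GenContFract.convs']
    simp [digitContFract]
  ext x
  constructor
  · rintro ⟨a, ha, hx⟩
    have ha' : ∀ n, 1 ≤ a n ∧ a n ≤ 4 := fun n => Finset.mem_Icc.1 (ha n)
    refine ⟨fun n => ⟨a n - 1, by have := ha' n; omega⟩, ?_⟩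
    refine tendsto_nhds_unique (key a _ fun n => ?_) hx
    have := ha' n
    simp only; omega
  · rintro ⟨b, rfl⟩
    refine ⟨fun n => b n + 1, fun n => ?_, key _ b fun _ => rfl⟩
    exact Finset.mem_Icc.2 ⟨Nat.le_add_left _ _, (b n).isLt⟩

/-! ### The transfer operator and its iterates -/

/-- The words of a given length. -/
def wordsOfLength : ℕ → Finset (List (Fin 4))
  | 0 => {[]}
  | n + 1 => (Finset.univ ×ˢ wordsOfLength n).image fun p => p.1 :: p.2

theorem mem_wordsOfLength {n : ℕ} {w : List (Fin 4)} : w ∈ wordsOfLength n ↔ w.length = n := by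
  induction n generalizing w with
  | zero => simp [wordsOfLength]
  | succ n ih =>
    cases w with
    | nil => simp [wordsOfLength]
    | cons i w => simp [wordsOfLength, ih]

theorem sum_wordsOfLength_succ (g : List (Fin 4) → ℝ) (n : ℕ) :
    ∑ w ∈ wordsOfLength (n + 1), g w = ∑ w ∈ wordsOfLength n, ∑ i, g (i :: w) := by
  rw [wordsOfLength, Finset.sum_image, Finset.sum_product_right]
  rintro ⟨i, w⟩ _ ⟨j, v⟩ _ h
  simpa using h

/-- The transfer operator with parameter `s`. -/
noncomputable def transferOp (s : ℝ) (f : ℝ → ℝ) (x : ℝ) : ℝ :=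
  ∑ i, (1 / (digitVal i + x) ^ 2) ^ s * f (1 / (digitVal i + x))

/-- The `n`-th iterate of the transfer operator as a sum over words. -/
noncomputable def wordSum (s : ℝ) (f : ℝ → ℝ) (x : ℝ) (n : ℕ) : ℝ :=
  ∑ w ∈ wordsOfLength n, wordDer w x ^ s * f (wordMap w x)

/-- A prepended letter is the outermost branch, so the chain rule exhibits `L^(n+1) f` as `L^n (L
f)`; a one-step inequality for `f` thus passes to all iterates. -/
theorem wordSum_succ (s : ℝ) (f : ℝ → ℝ) {x : ℝ} (hx : 0 ≤ x) (n : ℕ) :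
    wordSum s f x (n + 1) =
      ∑ w ∈ wordsOfLength n, wordDer w x ^ s * transferOp s f (wordMap w x) := by
  rw [wordSum, sum_wordsOfLength_succ]
  refine Finset.sum_congr rfl fun w _ => ?_
  rw [transferOp, Finset.mul_sum]
  refine Finset.sum_congr rfl fun i _ => ?_
  have := wordDer_pos w hx
  simp only [wordDer, wordMap]
  rw [← mul_one_div, Real.mul_rpow (by positivity) (by positivity), mul_assoc]

theorem wordSum_le {s : ℝ} {f : ℝ → ℝ} (h : ∀ x ∈ coreInterval, transferOp s f x ≤ f x)
    {x : ℝ} (hx : x ∈ coreInterval) (n : ℕ) : wordSum s f x n ≤ f x := by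
  induction n with
  | zero => simp [wordSum, wordsOfLength, wordDer, wordMap]
  | succ n ih =>
    rw [wordSum_succ s f (coreInterval_nonneg hx)]
    refine le_trans (Finset.sum_le_sum fun w _ => ?_) ih
    have := wordDer_pos w (coreInterval_nonneg hx)
    exact mul_le_mul_of_nonneg_left (h _ (wordMap_mem_coreInterval w hx)) (by positivity)

theorem wordSum_monotone {s : ℝ} {f : ℝ → ℝ} (h : ∀ x ∈ coreInterval, f x ≤ transferOp s f x)
    {x : ℝ} (hx : x ∈ coreInterval) : Monotone (wordSum s f x) := by
  refine monotone_nat_of_le_succ fun n => ?_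
  rw [wordSum_succ s f (coreInterval_nonneg hx)]
  refine Finset.sum_le_sum fun w _ => ?_
  have := wordDer_pos w (coreInterval_nonneg hx)
  exact mul_le_mul_of_nonneg_left (h _ (wordMap_mem_coreInterval w hx)) (by positivity)

/-! ### Upper bound for the dimension -/

/-- The cylinders of length `n` cover the set with mesh tending to 0, and their diameters are at
most `4 * wordDer`, so their `s`-sums are at most `4^s * f(1/2) / m`. -/
theorem hausdorffMeasure_contFractSet_four_ne_top {s : ℝ} (hs : 0 ≤ s) {f : ℝ → ℝ} {m : ℝ}
    (hm : 0 < m) (hf : ∀ x ∈ coreInterval, m ≤ f x)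
    (h : ∀ x ∈ coreInterval, transferOp s f x ≤ f x) :
    MeasureTheory.Measure.hausdorffMeasure s (contFractSet 4) ≠ ⊤ := by
  set z : ℝ := 1 / 2
  have hz : z ∈ coreInterval := half_mem_coreInterval
  have hz1 : z ∈ Set.Icc (0 : ℝ) 1 := ⟨coreInterval_nonneg hz, coreInterval_le_one hz⟩
  have hdiam : ∀ w, Metric.ediam (wordMap w '' Set.Icc 0 1) ≤ ENNReal.ofReal (4 * wordDer w z) := by
    intro w
    refine Metric.ediam_le ?_
    rintro _ ⟨x, hx, rfl⟩ _ ⟨y, hy, rfl⟩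
    rw [edist_dist, Real.dist_eq]
    exact ENNReal.ofReal_le_ofReal (abs_wordMap_sub_le w hx hy hz1)
  have hsum : ∀ n, ∑ i : wordsOfLength n, Metric.ediam (wordMap (i : List (Fin 4)) '' Set.Icc 0 1) ^ s
      ≤ ENNReal.ofReal (4 ^ s * (f z / m)) := by
    intro n
    rw [Finset.sum_coe_sort (wordsOfLength n)
      (fun w => Metric.ediam (wordMap w '' Set.Icc 0 1) ^ s)]
    calc ∑ w ∈ wordsOfLength n, Metric.ediam (wordMap w '' Set.Icc 0 1) ^ s
        ≤ ∑ w ∈ wordsOfLength n, ENNReal.ofReal (4 ^ s * wordDer w z ^ s) := by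
          refine Finset.sum_le_sum fun w _ => ?_
          have h0 := wordDer_pos w hz1.1
          rw [← Real.mul_rpow (by norm_num) h0.le,
            ← ENNReal.ofReal_rpow_of_nonneg (by positivity) hs]
          exact ENNReal.rpow_le_rpow (hdiam w) hs
      _ = ENNReal.ofReal (∑ w ∈ wordsOfLength n, 4 ^ s * wordDer w z ^ s) := by
          rw [ENNReal.ofReal_sum_of_nonneg]
          intro w _
          have h0 := wordDer_pos w hz1.1
          positivity
      _ ≤ _ := by
          refine ENNReal.ofReal_le_ofReal ?_
          rw [← Finset.mul_sum]
          refine mul_le_mul_of_nonneg_left ?_ (by positivity)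
          rw [le_div_iff₀ hm, Finset.sum_mul]
          refine le_trans (Finset.sum_le_sum fun w _ => ?_) (wordSum_le h hz n)
          have h0 := wordDer_pos w hz1.1
          exact mul_le_mul_of_nonneg_left (hf _ (wordMap_mem_coreInterval w hz)) (by positivity)
  refine ne_top_of_le_ne_top ENNReal.ofReal_ne_top (le_trans
    (MeasureTheory.Measure.hausdorffMeasure_le_liminf_sum (ι := fun n => wordsOfLength n) s
      (contFractSet 4) (l := atTop) (fun n => ENNReal.ofReal (4 * (25 / 36) ^ n)) ?_
      (fun n w => wordMap (w : List (Fin 4)) '' Set.Icc 0 1) ?_ ?_)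
    (le_trans (liminf_le_liminf (Eventually.of_forall hsum)) (le_of_eq (liminf_const _))))
  · have h1 := (tendsto_pow_atTop_nhds_zero_of_lt_one (r := (25 / 36 : ℝ)) (by norm_num)
      (by norm_num)).const_mul 4
    simpa using ENNReal.tendsto_ofReal h1
  · refine Eventually.of_forall fun n i => (hdiam i).trans (ENNReal.ofReal_le_ofReal ?_)
    have := wordDer_le_pow i hz
    rw [mem_wordsOfLength.1 i.2] at this
    linarith
  · refine Eventually.of_forall fun n => ?_
    rw [contFractSet_four]
    rintro _ ⟨b, rfl⟩
    refine Set.mem_iUnion.2 ⟨⟨prefixWord b n, mem_wordsOfLength.2 (length_prefixWord b n)⟩, ?_⟩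
    have := cfValue_mem_coreInterval fun k => b (k + n)
    exact ⟨_, ⟨coreInterval_nonneg this, coreInterval_le_one this⟩, (cfValue_eq_wordMap b n).symm⟩

theorem dimH_contFractSet_four_le {s : ℝ} (hs : 0 ≤ s) {f : ℝ → ℝ} {m : ℝ}
    (hm : 0 < m) (hf : ∀ x ∈ coreInterval, m ≤ f x)
    (h : ∀ x ∈ coreInterval, transferOp s f x ≤ f x) :
    dimH (contFractSet 4) ≤ ENNReal.ofReal s := by
  have := hausdorffMeasure_contFractSet_four_ne_top hs hm hf h
  rw [← Real.coe_toNNReal s hs] at this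
  exact dimH_le_of_hausdorffMeasure_ne_top this

/-! ### Lower bound for the dimension -/

/-- `coreInterval` has length `19/30 < 1`, so denominators with different digits differ by at least
`11/30`; each is at most `29/6`. -/
theorem le_abs_cfValue_sub {a b : ℕ → Fin 4} (h : a 0 ≠ b 0) :
    1 / 100 ≤ |cfValue a - cfValue b| := by
  rw [cfValue_eq_branch a, cfValue_eq_branch b]
  set x := cfValue fun k => a (k + 1)
  set y := cfValue fun k => b (k + 1)
  obtain ⟨hx1, hx2⟩ : x ∈ coreInterval := cfValue_mem_coreInterval _
  obtain ⟨hy1, hy2⟩ : y ∈ coreInterval := cfValue_mem_coreInterval _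
  have ha := one_le_digitVal (a 0)
  have hb := one_le_digitVal (b 0)
  have ha' := digitVal_le (a 0)
  have hb' := digitVal_le (b 0)
  have hab : 1 ≤ |digitVal (b 0) - digitVal (a 0)| := by
    have h1 : (1 : ℤ) ≤ |((b 0 : ℕ) : ℤ) - (a 0 : ℕ)| := by
      refine Int.one_le_abs (sub_ne_zero.2 fun h2 => h ?_)
      exact (Fin.ext (by exact_mod_cast h2)).symm
    have h2 : (1 : ℝ) ≤ |((b 0 : ℕ) : ℝ) - (a 0 : ℕ)| := by exact_mod_cast h1
    simpa [digitVal] using h2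
  have hyx : |x - y| ≤ 19 / 30 := by rw [abs_le]; constructor <;> linarith
  have hnum : 11 / 30 ≤ |digitVal (b 0) + y - (digitVal (a 0) + x)| := by
    have := abs_sub_abs_le_abs_sub (digitVal (b 0) - digitVal (a 0)) (x - y)
    rw [show digitVal (b 0) + y - (digitVal (a 0) + x)
      = digitVal (b 0) - digitVal (a 0) - (x - y) by ring]
    linarith
  rw [div_sub_div _ _ (by positivity) (by positivity), abs_div, one_mul, mul_one,
    abs_of_pos (a := (digitVal (a 0) + x) * _) (by positivity), le_div_iff₀ (by positivity)]
  nlinarith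

/-- Separation after the common prefix is carried back by `sq_wordMap_sub`; `400` is the distortion
constant 4 times 100. -/
theorem wordDer_le_abs_cfValue_sub {a b : ℕ → Fin 4} {n : ℕ} (h : ∀ k < n, a k = b k)
    (hn : a n ≠ b n) {z : ℝ} (hz : 0 ≤ z) :
    wordDer (prefixWord a n) z ≤ 400 * |cfValue a - cfValue b| := by
  have h1 : 1 / 100 ≤ |cfValue (fun k => a (k + n)) - cfValue fun k => b (k + n)| :=
    le_abs_cfValue_sub (by simpa using hn)
  rw [cfValue_eq_wordMap a n, cfValue_eq_wordMap b n, ← prefixWord_congr h]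
  set w := prefixWord a n
  set x := cfValue fun k => a (k + n)
  set y := cfValue fun k => b (k + n)
  have hx : x ∈ coreInterval := cfValue_mem_coreInterval _
  have hy : y ∈ coreInterval := cfValue_mem_coreInterval _
  have hx0 := coreInterval_nonneg hx
  have hy0 := coreInterval_nonneg hy
  have h2 := wordDer_pos w hz
  have h3 := wordDer_le_four_mul w hz hx0 (coreInterval_le_one hx)
  have h4 := wordDer_le_four_mul w hz hy0 (coreInterval_le_one hy)
  refine le_of_abs_le (abs_le_of_sq_le_sq ?_ (by positivity))
  rw [mul_pow, sq_abs, sq_wordMap_sub w hx0 hy0, ← sq_abs (x - y)]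
  have h5 : (1 / 100) ^ 2 ≤ |x - y| ^ 2 := by gcongr
  have h6 : (wordDer w z / 4) * (wordDer w z / 4) ≤ wordDer w x * wordDer w y := by
    have : 0 < wordDer w x := wordDer_pos w hx0
    gcongr <;> linarith
  calc wordDer w z ^ 2 = 400 ^ 2 * ((1 / 100) ^ 2 * ((wordDer w z / 4) * (wordDer w z / 4))) := by
        ring
    _ ≤ _ := by gcongr

/-- Every set of reals is covered, as far as coded points are concerned, by one cylinder whose size
is controlled by the diameter of the set. -/
theorem exists_cylinder (t : Set ℝ) {s : ℝ} (hs : 0 < s) {z : ℝ} (hz : z ∈ coreInterval)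
    {ε : ENNReal} (hε : 0 < ε) :
    ∃ w : List (Fin 4), (∀ a, cfValue a ∈ t → prefixWord a w.length = w) ∧
      ENNReal.ofReal (wordDer w z ^ s) ≤
        ENNReal.ofReal (400 ^ s) * (⨆ _ : t.Nonempty, Metric.ediam t ^ s) + ε := by
  have hz0 := coreInterval_nonneg hz
  -- With two distinct codes in `t`, take their longest prefix common to all codes in `t`. Otherwise
  -- the diameter may be 0, and a long word of weight below `ε` is used.
  by_cases hex : ∃ n, ∃ a b : ℕ → Fin 4, cfValue a ∈ t ∧ cfValue b ∈ t ∧ a n ≠ b n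
  · classical
    obtain ⟨a, b, ha, hb, hab⟩ := Nat.find_spec hex
    have hmin : ∀ k < Nat.find hex, ∀ a b, cfValue a ∈ t → cfValue b ∈ t → a k = b k := by
      intro k hk a b ha hb
      by_contra hne
      exact Nat.find_min hex hk ⟨a, b, ha, hb, hne⟩
    set n := Nat.find hex
    refine ⟨prefixWord a n, fun c hc => ?_, le_add_right ?_⟩
    · rw [length_prefixWord]
      exact prefixWord_congr fun k hk => hmin k hk c a hc ha
    · have h1 := wordDer_le_abs_cfValue_sub (fun k hk => hmin k hk a b ha hb) hab hz0
      have h0 := wordDer_pos (prefixWord a n) hz0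
      calc ENNReal.ofReal (wordDer (prefixWord a n) z ^ s)
          ≤ ENNReal.ofReal ((400 * |cfValue a - cfValue b|) ^ s) :=
            ENNReal.ofReal_le_ofReal (Real.rpow_le_rpow h0.le h1 hs.le)
        _ = ENNReal.ofReal (400 ^ s) * (ENNReal.ofReal |cfValue a - cfValue b|) ^ s := by
            rw [Real.mul_rpow (by norm_num) (abs_nonneg _), ENNReal.ofReal_mul (by positivity),
              ENNReal.ofReal_rpow_of_nonneg (abs_nonneg _) hs.le]
        _ ≤ _ := by
            refine mul_le_mul_right ?_ _
            refine le_iSup_of_le ⟨_, ha⟩ (ENNReal.rpow_le_rpow ?_ hs.le)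
            rw [← Real.dist_eq, ← edist_dist]
            exact Metric.edist_le_ediam_of_mem ha hb
  · push Not at hex
    obtain ⟨a, ha⟩ : ∃ a : ℕ → Fin 4, ∀ b, cfValue b ∈ t → b = a := by
      by_cases h : ∃ a, cfValue a ∈ t
      · obtain ⟨a, ha⟩ := h
        exact ⟨a, fun b hb => funext fun n => hex n b a hb ha⟩
      · exact ⟨fun _ => 0, fun b hb => (h ⟨b, hb⟩).elim⟩
    have hlim : Tendsto (fun n => ENNReal.ofReal (((25 / 36 : ℝ) ^ n) ^ s)) atTop (𝓝 0) := by
      have h1 := (tendsto_pow_atTop_nhds_zero_of_lt_one (r := (25 / 36 : ℝ)) (by norm_num)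
        (by norm_num)).rpow_const (p := s) (Or.inr hs.le)
      rw [Real.zero_rpow hs.ne'] at h1
      simpa using ENNReal.tendsto_ofReal h1
    obtain ⟨n, hn⟩ := (hlim.eventually (gt_mem_nhds hε)).exists
    refine ⟨prefixWord a n, fun b hb => by rw [ha b hb, length_prefixWord], le_add_left ?_⟩
    refine le_trans (ENNReal.ofReal_le_ofReal ?_) hn.le
    have := wordDer_le_pow (prefixWord a n) hz
    rw [length_prefixWord] at this
    exact Real.rpow_le_rpow (wordDer_pos _ hz0).le this hs.le

theorem isOpen_cylinder (w : List (Fin 4)) :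
    IsOpen {a : ℕ → Fin 4 | prefixWord a w.length = w} := by
  generalize hn : w.length = n
  clear hn
  induction n generalizing w with
  | zero => simp [prefixWord]
  | succ n ih =>
    cases w with
    | nil => simp [prefixWord]
    | cons i w =>
      simp only [prefixWord, List.cons.injEq, Set.ofPred_and]
      have hc : Continuous fun a : ℕ → Fin 4 => a 0 := continuous_apply 0
      have h0 : IsOpen {a : ℕ → Fin 4 | a 0 = i} := (isOpen_discrete {i}).preimage hc
      have hs : Continuous fun (a : ℕ → Fin 4) k => a (k + 1) :=
        continuous_pi fun k => continuous_apply (k + 1)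
      exact h0.inter ((ih w).preimage hs)

theorem prefixWord_getD (u : List (Fin 4)) :
    prefixWord (fun k => u.getD k 0) u.length = u := by
  induction u with
  | nil => rfl
  | cons j u ih => simpa [prefixWord] using ih

/-- A finite family of cylinders covering the sequence space has total weight bounded below. -/
theorem one_le_sum_cylinders {s : ℝ} (hs : 0 ≤ s) {f : ℝ → ℝ} {m M : ℝ} (hm : 0 < m)
    (hf : ∀ x ∈ coreInterval, m ≤ f x) (hM : ∀ x ∈ coreInterval, f x ≤ M)
    (h : ∀ x ∈ coreInterval, f x ≤ transferOp s f x) {z : ℝ} (hz : z ∈ coreInterval)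
    {ι : Type*} (I : Finset ι) (w : ι → List (Fin 4))
    (hcov : ∀ a : ℕ → Fin 4, ∃ i ∈ I, prefixWord a (w i).length = w i) :
    1 ≤ 4 ^ s * (M / m) * ∑ i ∈ I, wordDer (w i) z ^ s := by
  have hz0 := coreInterval_nonneg hz
  have hM0 : 0 < M := hm.trans_le ((hf z hz).trans (hM z hz))
  obtain ⟨N, hN⟩ : ∃ N, ∀ i ∈ I, (w i).length ≤ N :=
    ⟨I.sup fun i => (w i).length, fun i hi => Finset.le_sup (f := fun i => (w i).length) hi⟩
  set g : List (Fin 4) → ℝ := fun u => wordDer u z ^ s * f (wordMap u z)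
  have hg : ∀ u, 0 ≤ g u := fun u => by
    have := wordDer_pos u hz0
    have := hm.trans_le (hf _ (wordMap_mem_coreInterval u hz))
    positivity
  have hpos : 0 < wordSum s f z N := by
    refine lt_of_lt_of_le ?_ (wordSum_monotone h hz (Nat.zero_le N))
    simpa [wordSum, wordsOfLength, wordDer, wordMap] using hm.trans_le (hf z hz)
  -- Completing `w i` to length `N` costs `4^s` by distortion and `M / m` for the change of argument
  -- of `f`; monotonicity then replaces `N - (w i).length` by `N`.
  have hone : ∀ i ∈ I, ∑ v ∈ wordsOfLength (N - (w i).length), g (w i ++ v) ≤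
      4 ^ s * (M / m) * wordDer (w i) z ^ s * wordSum s f z N := by
    intro i hi
    have h1 := wordDer_pos (w i) hz0
    calc ∑ v ∈ wordsOfLength (N - (w i).length), g (w i ++ v)
        ≤ ∑ v ∈ wordsOfLength (N - (w i).length), 4 ^ s * (M / m) * wordDer (w i) z ^ s * g v := by
          refine Finset.sum_le_sum fun v _ => ?_
          have h2 := wordMap_mem_coreInterval v hz
          have h3 := wordDer_pos v hz0
          have h4 := wordDer_pos (w i) (coreInterval_nonneg h2)
          have h5 : wordDer (w i) (wordMap v z) ^ s ≤ 4 ^ s * wordDer (w i) z ^ s := by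
            rw [← Real.mul_rpow (by norm_num) h1.le]
            exact Real.rpow_le_rpow h4.le (wordDer_le_four_mul _ (coreInterval_nonneg h2) hz0
              (coreInterval_le_one hz)) hs
          have h6 : f (wordMap (w i ++ v) z) ≤ M / m * f (wordMap v z) := by
            refine (hM _ (wordMap_mem_coreInterval _ hz)).trans ?_
            rw [div_mul_eq_mul_div, le_div_iff₀ hm]
            exact mul_le_mul_of_nonneg_left (hf _ h2) hM0.le
          have h7 : 0 < f (wordMap (w i ++ v) z) :=
            hm.trans_le (hf _ (wordMap_mem_coreInterval _ hz))
          simp only [g]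
          rw [wordDer_append, Real.mul_rpow h4.le h3.le]
          calc _ ≤ 4 ^ s * wordDer (w i) z ^ s * wordDer v z ^ s *
                (M / m * f (wordMap v z)) := by gcongr
            _ = _ := by ring
      _ = 4 ^ s * (M / m) * wordDer (w i) z ^ s * wordSum s f z (N - (w i).length) := by
          rw [← Finset.mul_sum]; rfl
      _ ≤ _ := mul_le_mul_of_nonneg_left (wordSum_monotone h hz (Nat.sub_le _ _)) (by positivity)
  have htot : wordSum s f z N ≤ ∑ i ∈ I, ∑ v ∈ wordsOfLength (N - (w i).length), g (w i ++ v) := by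
    rw [Finset.sum_sigma']
    refine le_trans (Finset.sum_le_sum_of_subset_of_nonneg
      (t := (I.sigma fun i => wordsOfLength (N - (w i).length)).image fun p => w p.1 ++ p.2)
      (fun u hu => ?_) fun _ _ _ => hg _) ?_
    · have hu := mem_wordsOfLength.1 hu
      -- Padding by the letter 0 makes `u` an infinite sequence; only its first `N` letters matter.
      obtain ⟨i, hi, hi'⟩ := hcov fun k => u.getD k 0
      have hpre : prefixWord (fun k => u.getD k 0) N = u := by
        rw [← hu]; exact prefixWord_getD u
      rw [← Nat.add_sub_of_le (hN i hi), prefixWord_add, hi'] at hpre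
      exact Finset.mem_image.2 ⟨⟨i, _⟩, Finset.mem_sigma.2
        ⟨hi, mem_wordsOfLength.2 (length_prefixWord _ _)⟩, hpre⟩
    · exact Finset.sum_image_le_of_nonneg fun _ _ => hg _
  have := htot.trans (Finset.sum_le_sum hone)
  rw [← Finset.sum_mul, ← Finset.mul_sum] at this
  exact le_of_mul_le_mul_right (by linarith) hpos

/-- A cover with small `s`-sum would yield open cylinders covering the compact sequence space, and
finitely many of them would violate `one_le_sum_cylinders`. No measure on the set is constructed. -/
theorem hausdorffMeasure_contFractSet_four_ne_zero {s : ℝ} (hs : 0 < s) {f : ℝ → ℝ} {m M : ℝ}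
    (hm : 0 < m) (hf : ∀ x ∈ coreInterval, m ≤ f x) (hM : ∀ x ∈ coreInterval, f x ≤ M)
    (h : ∀ x ∈ coreInterval, f x ≤ transferOp s f x) :
    MeasureTheory.Measure.hausdorffMeasure s (contFractSet 4) ≠ 0 := by
  intro h0
  have hz := half_mem_coreInterval
  have hM0 : 0 < M := hm.trans_le ((hf _ hz).trans (hM _ hz))
  set K : ℝ := 4 ^ s * (M / m)
  have hK : 0 < K := by positivity
  set c : ENNReal := ENNReal.ofReal (1 / K)
  have hc : 0 < c := ENNReal.ofReal_pos.2 (by positivity)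
  have hc2 : 0 < c / 2 := ENNReal.half_pos hc.ne'
  set A : ENNReal := ENNReal.ofReal (400 ^ s)
  have hA : A ≠ ⊤ := ENNReal.ofReal_ne_top
  have hA0 : A ≠ 0 := (ENNReal.ofReal_pos.2 (by positivity)).ne'
  obtain ⟨t, ht, hsum⟩ : ∃ t : ℕ → Set ℝ, contFractSet 4 ⊆ ⋃ n, t n ∧
      ∑' n, ⨆ _ : (t n).Nonempty, Metric.ediam (t n) ^ s < c / 2 / A := by
    rw [MeasureTheory.Measure.hausdorffMeasure_apply] at h0
    -- Any positive mesh would do.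
    have h1 := (iSup₂_eq_bot.1 h0) 1 one_pos
    have h2 : (⊥ : ENNReal) < c / 2 / A := ENNReal.div_pos hc2.ne' hA
    rw [← h1] at h2
    obtain ⟨t, h3⟩ := iInf_lt_iff.1 h2
    obtain ⟨h4, h5⟩ := iInf_lt_iff.1 h3
    obtain ⟨_, h6⟩ := iInf_lt_iff.1 h5
    exact ⟨t, h4, h6⟩
  obtain ⟨ε, hε, hεsum⟩ := ENNReal.exists_pos_sum_of_countable' hc2.ne' ℕ
  choose w hw hwsum using fun n => exists_cylinder (t n) hs hz (hε n)
  obtain ⟨I, hI⟩ := (isCompact_univ (X := ℕ → Fin 4)).elim_finite_subcover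
    (fun n => {a : ℕ → Fin 4 | prefixWord a (w n).length = w n}) (fun n => isOpen_cylinder (w n))
    (fun a _ => by
      have : cfValue a ∈ contFractSet 4 := by rw [contFractSet_four]; exact ⟨a, rfl⟩
      obtain ⟨n, hn⟩ := Set.mem_iUnion.1 (ht this)
      exact Set.mem_iUnion.2 ⟨n, hw n a hn⟩)
  have h1 := one_le_sum_cylinders hs.le hm hf hM h hz I w fun a => by
    simpa using hI (Set.mem_univ a)
  have h2 : ENNReal.ofReal (∑ i ∈ I, wordDer (w i) (1 / 2) ^ s) < c := by
    rw [ENNReal.ofReal_sum_of_nonneg fun i _ => by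
      have := wordDer_pos (w i) (coreInterval_nonneg hz)
      positivity]
    calc ∑ i ∈ I, ENNReal.ofReal (wordDer (w i) (1 / 2) ^ s)
        ≤ ∑' n, ENNReal.ofReal (wordDer (w n) (1 / 2) ^ s) := ENNReal.sum_le_tsum I
      _ ≤ ∑' n, (A * (⨆ _ : (t n).Nonempty, Metric.ediam (t n) ^ s) + ε n) :=
          ENNReal.tsum_le_tsum hwsum
      _ = A * (∑' n, ⨆ _ : (t n).Nonempty, Metric.ediam (t n) ^ s) + ∑' n, ε n := by
          rw [ENNReal.tsum_add, ENNReal.tsum_mul_left]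
      _ < c / 2 + c / 2 := by
          refine ENNReal.add_lt_add ?_ hεsum
          rw [mul_comm]
          exact (ENNReal.lt_div_iff_mul_lt (Or.inl hA0) (Or.inl hA)).1 hsum
      _ = c := ENNReal.add_halves c
  have h3 := (ENNReal.ofReal_lt_ofReal_iff (by positivity)).1 h2
  rw [lt_div_iff₀ hK, mul_comm] at h3
  exact absurd h1 (not_le.2 h3)

theorem le_dimH_contFractSet_four {s : ℝ} (hs : 0 < s) {f : ℝ → ℝ} {m M : ℝ}
    (hm : 0 < m) (hf : ∀ x ∈ coreInterval, m ≤ f x) (hM : ∀ x ∈ coreInterval, f x ≤ M)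
    (h : ∀ x ∈ coreInterval, f x ≤ transferOp s f x) :
    ENNReal.ofReal s ≤ dimH (contFractSet 4) := by
  have := hausdorffMeasure_contFractSet_four_ne_zero hs hm hf hM h
  rw [← Real.coe_toNNReal s hs.le] at this
  exact le_dimH_of_hausdorffMeasure_ne_zero this

/-! ### Computable integer polynomial arithmetic -/

/-- Evaluation of a polynomial given by its list of integer coefficients. -/
noncomputable def polyEval : List ℤ → ℝ → ℝ
  | [], _ => 0
  | a :: l, x => a + x * polyEval l x

def polyEvalInt : List ℤ → ℤ → ℤ
  | [], _ => 0
  | a :: l, x => a + x * polyEvalInt l x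

def polyAdd : List ℤ → List ℤ → List ℤ
  | [], m => m
  | a :: l, [] => a :: l
  | a :: l, b :: m => (a + b) :: polyAdd l m

def polyScale (c : ℤ) : List ℤ → List ℤ
  | [] => []
  | a :: l => (c * a) :: polyScale c l

def polyMul : List ℤ → List ℤ → List ℤ
  | [], _ => []
  | a :: l, m => polyAdd (polyScale a m) (0 :: polyMul l m)

def polyPow (l : List ℤ) : ℕ → List ℤ
  | 0 => [1]
  | n + 1 => polyMul l (polyPow l n)

def polyDeriv : List ℤ → List ℤ
  | [] => []
  | _ :: l => polyAdd l (0 :: polyDeriv l)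

/-- The homogenization `∑ k, a k * u ^ k * v ^ (d - k)` of a polynomial `∑ k ≤ d, a k * X ^ k`. -/
def polyHom (u v : List ℤ) : List ℤ → List ℤ
  | [] => []
  | a :: l => polyAdd (polyScale a (polyPow v l.length)) (polyMul u (polyHom u v l))

/-- An upper bound for the absolute value of a polynomial on `|x| ≤ p / q`. -/
def polyNorm (p q : ℕ) : List ℤ → ℕ
  | [] => 0
  | a :: l => a.natAbs + p * polyNorm p q l / q + 1

theorem polyEvalInt_cast (l : List ℤ) (x : ℤ) : ((polyEvalInt l x : ℤ) : ℝ) = polyEval l x := by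
  induction l with
  | nil => simp [polyEval, polyEvalInt]
  | cons a l ih => simp [polyEval, polyEvalInt, ih]

theorem polyEval_add (l m : List ℤ) (x : ℝ) :
    polyEval (polyAdd l m) x = polyEval l x + polyEval m x := by
  induction l generalizing m with
  | nil => simp [polyAdd, polyEval]
  | cons a l ih =>
    cases m with
    | nil => simp [polyAdd, polyEval]
    | cons b m => simp only [polyAdd, polyEval, ih]; push_cast; ring

theorem polyEval_scale (c : ℤ) (l : List ℤ) (x : ℝ) :
    polyEval (polyScale c l) x = c * polyEval l x := by
  induction l with
  | nil => simp [polyScale, polyEval]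
  | cons a l ih => simp only [polyScale, polyEval, ih]; push_cast; ring

theorem polyEval_mul (l m : List ℤ) (x : ℝ) :
    polyEval (polyMul l m) x = polyEval l x * polyEval m x := by
  induction l with
  | nil => simp [polyMul, polyEval]
  | cons a l ih =>
    simp only [polyMul, polyEval_add, polyEval_scale, polyEval, ih]; push_cast; ring

theorem polyEval_pow (l : List ℤ) (n : ℕ) (x : ℝ) :
    polyEval (polyPow l n) x = polyEval l x ^ n := by
  induction n with
  | zero => simp [polyPow, polyEval]
  | succ n ih => rw [polyPow, polyEval_mul, ih, pow_succ']

theorem hasDerivAt_polyEval (l : List ℤ) (x : ℝ) :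
    HasDerivAt (polyEval l) (polyEval (polyDeriv l) x) x := by
  induction l with
  | nil => exact hasDerivAt_const x 0
  | cons a l ih =>
    have h := ((hasDerivAt_id x).mul ih).const_add (a : ℝ)
    refine h.congr_deriv ?_
    simp [polyDeriv, polyEval_add, polyEval]

/-- The extra factor on the left avoids the truncated degree `l.length - 1`. -/
theorem polyEval_hom (u v l : List ℤ) {x : ℝ} (hv : polyEval v x ≠ 0) :
    polyEval (polyHom u v l) x * polyEval v x =
      polyEval v x ^ l.length * polyEval l (polyEval u x / polyEval v x) := by
  induction l with
  | nil => simp [polyHom, polyEval]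
  | cons a l ih =>
    simp only [polyHom, polyEval_add, polyEval_scale, polyEval_mul, polyEval_pow, List.length_cons,
      polyEval]
    rw [add_mul, mul_assoc (polyEval u x), ih, pow_succ]
    field_simp

theorem abs_polyEval_le {p q : ℕ} (hq : 0 < q) (l : List ℤ) {x : ℝ} (hx : |x| ≤ p / q) :
    |polyEval l x| ≤ polyNorm p q l := by
  induction l with
  | nil => simp [polyEval, polyNorm]
  | cons a l ih =>
    simp only [polyEval, polyNorm]
    have h1 : ((p * polyNorm p q l : ℕ) : ℝ) / q ≤ ((p * polyNorm p q l / q : ℕ) : ℝ) + 1 := by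
      rw [div_le_iff₀ (by positivity)]
      exact_mod_cast (Nat.lt_mul_of_div_lt (Nat.lt_add_one _) hq).le
    have h2 : |x * polyEval l x| ≤ p / q * polyNorm p q l := by
      rw [abs_mul]; gcongr
    have h3 : (p / q * polyNorm p q l : ℝ) = ((p * polyNorm p q l : ℕ) : ℝ) / q := by
      push_cast; ring
    have h4 : |(a : ℝ)| = (a.natAbs : ℝ) := by rw [Nat.cast_natAbs]; simp
    push_cast at h1 h3 ⊢
    linarith [abs_add_le (a : ℝ) (x * polyEval l x)]

/-! ### Numerical certificate and kernel checks -/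

/-- The dimension of `E 4` to fifteen decimal places. -/
noncomputable def dimApprox : ℝ := 788945557483154 / 10 ^ 15

/-- Taylor coefficients at `1 / 2`, with respect to `2 * x - 1` and scaled by `10 ^ 20`, of an
approximate eigenfunction of the transfer operator. -/
def eigPoly : List ℤ :=
  [100000000000000000000, -30651268547565326105, 8476831013499446179, -2334533571699083998,
   649305908667629414, -182292142015117251, 51530578449679567, -14636842106223504,
   4171798812767049, -1192128058849782, 341361659520682, -97915024882722, 28127065782735,
   -8090308076850, 2329766774659, -671611079179, 193793523339, -55967974306, 16176542853,
   -4678944342, 1354251535]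

/-- Scaled Taylor coefficients at `1 / 2` of `(i + 1 + x) ^ (-2 * dimApprox)`. -/
def weightPoly : Fin 4 → List ℤ
  | 0 =>
    [52740855109571009298, -27739775557705834048, 11918353490228238476, -4738063450857255622,
     1807528214485502901, -672146371175306779, 245628091272827590, -88635377640118740,
     31679359097119079, -11237831556449034, 3962418619081674, -1390195494655842, 485714654452720,
     -169102069002629, 58694084505615, -20318445722691, 7017437100336, -2418661671683,
     832104318157, -285804346266, 98020845294, -33572748044, 11484876512, -3924480694, 1339659155,
     -456875413, 155676731, -53002913, 18032279, -6130538, 2082877, -707235, 240002, -81402,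
     27595, -9350, 3167, -1072, 363, -123, 41]
  | 1 =>
    [23555590514430807777, -7433631396101003183, 1916309232794336784, -457089718502850661,
     104625348053832544, -23343551972389202, 5118378103697772, -1108186055858556, 237647483056967,
     -50581371477009, 10700884798589, -2252612346034, 472218546877, -98642030953, 20542754094,
     -4266837153, 884189522, -182849260, 37743929, -7778385, 1600628, -328935, 67515, -13842,
     2835, -580, 119, -24, 5]
  | 2 =>
    [13852235517865338802, -3122474192294347478, 574957034073371245, -97958745890404561,
     16015874015890192, -2552422896332962, 399751425986313, -61821893452588, 9469669117095,
     -1439673963465, 217553063237, -32711762050, 4898154539, -730841857, 108715643, -16129147,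
     2387386, -352649, 51996, -7654, 1125, -165, 24, -4, 1]
  | 3 =>
    [9317550995020894831, -1633564547587661363, 233952862941677159, -31002143319998412,
     3942345456931467, -488666082141018, 59525782961126, -7159998441469, 853023430753,
     -100866241213, 11855023519, -1386425974, 161465879, -18738172, 2167961, -250165, 28800,
     -3309, 379, -43, 5, -1, 0]

/-- Scaled Taylor coefficients at `1 / 2` of the summands of the transfer operator applied to the
approximate eigenfunction. -/
def imagePoly : Fin 4 → List ℤ
  | 0 =>
    [47807289301976009275, -19122563920049460179, 6307334923254234228, -1942665805823237217,
     579265926474952432, -169782007882407220, 49290657198831371, -14234553345460852,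
     4099340854629810, -1179045720546525, 338994956918130, -97486180733360, 28049258956128,
     -8076179199038, 2327204205418, -671153842823, 193722484627, -55970438965, 16195228778,
     -4702706418, 1380099898, -418540318, 139177426, -56617693, 30617049, -20806779, 15702969,
     -12134943, 9280647, -6943898, 5067516, -3606733, 2505777, -1701320, 1130233]
  | 1 =>
    [25084137266169428383, -6621599985982995476, 1433891892548507526, -288504633878945936,
     55933242685464983, -10612640986734024, 1986581658051719, -368590116189706, 67982972691558,
     -12488418664239, 2287874221077, -418378919368, 76418952138, -13948486661, 2545027512,
     -464302653, 84708560, -15456926, 2821140, -515058, 94066, -17185, 3141, -574, 105, -19, 4]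
  | 2 =>
    [15916481666553708898, -3141752571282573378, 507794789740946170, -76120836507780620,
     10975818362565880, -1546218396762597, 214551118555663, -29463078764243, 4016220993766,
     -544531520128, 73536765407, -9901516521, 1330267676, -178426903, 23902947, -3199303, 427940,
     -57217, 7648, -1022, 137, -18, 2, 0, 0]
  | 3 =>
    [11192091765300848954, -1765352070250296083, 227809407955757667, -27242295489120271,
     3130921144646504, -351274749215615, 38788474250181, -4235565842014, 458764553554,
     -49388389504, 5292253362, -565056031, 60161303, -6391124, 677756, -71773, 7592, -802, 85, -9,
     1, 0, 0]

/-- The coefficients of `10 ^ 15 * ((n + x) * A' + 2 * dimApprox * A)`, which vanishes if `A` is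
proportional to `(n + x) ^ (-2 * dimApprox)`. -/
def odeResidual (n : ℤ) (A : List ℤ) : List ℤ :=
  polyAdd (polyScale (10 ^ 15) (polyMul [n, 1] (polyDeriv A))) (polyScale 1577891114966308 A)

/-- Twice the distance from the centre `-(i + 1)` of the weight to `1 / 2`. -/
def nodeInt (i : Fin 4) : ℤ := 2 * (i : ℕ) + 3

theorem norm_odeResidual_le (i : Fin 4) :
    polyNorm 1 1 (odeResidual (nodeInt i) (weightPoly i)) ≤ 4000 * 10 ^ 15 := by
  revert i; decide +kernel

/-- Together with `weightPoly_step` this fixes the constants left free by the differential equation.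
The four weights are pieces of `u^(-2s)` on `[1, 5]`; it equals 1 at `u = 1`, and consecutive pieces
meet at integers, so no irrational power is evaluated. -/
theorem weightPoly_start : |polyEvalInt (weightPoly 0) (-1) - 10 ^ 20| ≤ 100 := by
  decide +kernel

theorem weightPoly_step (i : Fin 3) :
    |polyEvalInt (weightPoly i.succ) (-1) - polyEvalInt (weightPoly i.castSucc) 1| ≤ 100 := by
  revert i; decide +kernel

/-- Error of `imagePoly` after clearing `v^20`, where `v = nodeInt i + t`. For `|t| ≤ 2/3` one has
`3 * v ≥ 3 * nodeInt i - 2`, which explains the right side. -/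
theorem norm_imagePoly_le (i : Fin 4) :
    polyNorm 2 3 (polyAdd
      (polyMul (weightPoly i) (polyHom [4 - nodeInt i, -1] [nodeInt i, 1] eigPoly))
      (polyScale (-10 ^ 20) (polyMul (imagePoly i) (polyPow [nodeInt i, 1] 20)))) * 3 ^ 20 ≤
      30000 * 10 ^ 20 * (3 * nodeInt i - 2).toNat ^ 20 := by
  revert i; decide +kernel

theorem norm_sum_imagePoly_sub_le :
    polyNorm 2 3 (polyAdd (polyAdd (polyAdd (imagePoly 0) (imagePoly 1))
      (polyAdd (imagePoly 2) (imagePoly 3))) (polyScale (-1) eigPoly)) ≤ 400000 := by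
  decide +kernel

theorem norm_eigPoly_sub_le : polyNorm 2 3 (polyAdd eigPoly [-10 ^ 20]) ≤ 26 * 10 ^ 18 := by
  decide +kernel

theorem nodeInt_bounds (i : Fin 4) : (3 : ℝ) ≤ nodeInt i ∧ (nodeInt i : ℝ) ≤ 9 := by
  have h : (i : ℕ) ≤ 3 := by omega
  have h' : ((i : ℕ) : ℝ) ≤ 3 := by exact_mod_cast h
  have h0 : (0 : ℝ) ≤ ((i : ℕ) : ℝ) := by positivity
  constructor <;> simp only [nodeInt] <;> push_cast <;> linarith

theorem polyEval_odeResidual (n : ℤ) (A : List ℤ) (x : ℝ) :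
    polyEval (odeResidual n A) x =
      10 ^ 15 * ((n + x) * polyEval (polyDeriv A) x + 2 * dimApprox * polyEval A x) := by
  simp only [odeResidual, polyEval_add, polyEval_scale, polyEval_mul, polyEval, dimApprox]
  push_cast
  ring

/-! ### Weights compared with their polynomial approximations -/

/-- The quotient of the polynomial approximation by the weight it approximates. -/
noncomputable def weightRatio (i : Fin 4) (x : ℝ) : ℝ :=
  polyEval (weightPoly i) x * ((nodeInt i + x) / 2) ^ (2 * dimApprox)

/-- The derivative is a multiple of the residual, so a small residual makes the ratio nearly
constant. -/
theorem hasDerivAt_weightRatio (i : Fin 4) {x : ℝ} (hx : -1 ≤ x) :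
    HasDerivAt (weightRatio i) (((nodeInt i + x) / 2) ^ (2 * dimApprox - 1) / 2 *
      (polyEval (odeResidual (nodeInt i) (weightPoly i)) x / 10 ^ 15)) x := by
  have hn := (nodeInt_bounds i).1
  have hb : 0 < (nodeInt i + x) / 2 := by linarith
  have h1 : HasDerivAt (fun x : ℝ => ((nodeInt i : ℝ) + x) / 2) (1 / 2) x :=
    ((hasDerivAt_id x).const_add _).div_const 2
  refine ((hasDerivAt_polyEval (weightPoly i) x).mul
    (h1.rpow_const (p := 2 * dimApprox) (Or.inl hb.ne'))).congr_deriv ?_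
  rw [polyEval_odeResidual]
  have h2 : ((nodeInt i + x) / 2) ^ (2 * dimApprox) =
      ((nodeInt i + x) / 2) ^ (2 * dimApprox - 1) * ((nodeInt i + x) / 2) := by
    rw [← Real.rpow_add_one hb.ne']; congr 1; ring
  rw [h2]
  field_simp

theorem abs_weightRatio_sub_le (i : Fin 4) {x : ℝ} (hx : x ∈ Set.Icc (-1 : ℝ) 1) :
    |weightRatio i x - weightRatio i (-1)| ≤ 20000 := by
  obtain ⟨hn, hn'⟩ := nodeInt_bounds i
  have h := (convex_Icc (-1 : ℝ) 1).norm_image_sub_le_of_norm_hasDerivWithin_le (C := 10000)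
    (fun y hy => (hasDerivAt_weightRatio i hy.1).hasDerivWithinAt) (fun y hy => ?_)
    (⟨le_rfl, by norm_num⟩ : (-1 : ℝ) ∈ Set.Icc (-1 : ℝ) 1) hx
  · rw [Real.norm_eq_abs, Real.norm_eq_abs] at h
    have : |x - -1| ≤ 2 := by rw [abs_le]; constructor <;> linarith [hx.1, hx.2]
    linarith
  · have h1 : 1 ≤ (nodeInt i + y) / 2 := by linarith [hy.1]
    have h2 : (nodeInt i + y) / 2 ≤ 5 := by linarith [hy.2]
    have h3 : ((nodeInt i + y) / 2) ^ (2 * dimApprox - 1) ≤ 5 := by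
      refine (Real.rpow_le_rpow_of_exponent_le h1 (y := 2 * dimApprox - 1) (z := 1) ?_).trans ?_
      · rw [dimApprox]; norm_num
      · rwa [Real.rpow_one]
    have h4 : |polyEval (odeResidual (nodeInt i) (weightPoly i)) y| ≤ 4000 * 10 ^ 15 := by
      refine (abs_polyEval_le (p := 1) (q := 1) one_pos _ ?_).trans ?_
      · rw [abs_le]; constructor <;> push_cast <;> linarith [hy.1, hy.2]
      · exact_mod_cast norm_odeResidual_le i
    rw [Real.norm_eq_abs, abs_mul, abs_div, abs_div, abs_of_pos (a := _ ^ (_ : ℝ)) (by positivity)]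
    rw [abs_of_pos (by norm_num : (0 : ℝ) < 2), abs_of_pos (by norm_num : (0 : ℝ) < 10 ^ 15)]
    calc _ ≤ (5 / 2 : ℝ) * (4000 * 10 ^ 15 / 10 ^ 15) := by gcongr
      _ = 10000 := by norm_num

theorem abs_weightRatio_zero_sub_le : |weightRatio 0 (-1) - 10 ^ 20| ≤ 100 := by
  have h : weightRatio 0 (-1) = ((polyEvalInt (weightPoly 0) (-1) : ℤ) : ℝ) := by
    rw [weightRatio, polyEvalInt_cast]
    simp only [nodeInt]
    norm_num
  rw [h]
  exact_mod_cast weightPoly_start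

theorem abs_weightRatio_step (i : Fin 3) :
    |weightRatio i.succ (-1) - weightRatio i.castSucc 1| ≤ 1600 := by
  have hi : (i : ℕ) ≤ 2 := by omega
  have hi' : ((i : ℕ) : ℝ) ≤ 2 := by exact_mod_cast hi
  have hi0 : (0 : ℝ) ≤ ((i : ℕ) : ℝ) := by positivity
  have h1 : ((nodeInt i.succ : ℤ) + (-1 : ℝ)) / 2 = (i : ℕ) + 2 := by
    simp only [nodeInt, Fin.val_succ]; push_cast; ring
  have h2 : ((nodeInt i.castSucc : ℤ) + (1 : ℝ)) / 2 = (i : ℕ) + 2 := by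
    simp only [nodeInt, Fin.val_castSucc]; push_cast; ring
  have h3 : (((i : ℕ) : ℝ) + 2) ^ (2 * dimApprox) ≤ 16 := by
    calc (((i : ℕ) : ℝ) + 2) ^ (2 * dimApprox) ≤ (((i : ℕ) : ℝ) + 2) ^ (2 : ℝ) :=
          Real.rpow_le_rpow_of_exponent_le (by linarith) (by rw [dimApprox]; norm_num)
      _ = (((i : ℕ) : ℝ) + 2) ^ 2 := by norm_cast
      _ ≤ 4 ^ 2 := by gcongr; linarith
      _ = 16 := by norm_num
  have h4 : |polyEval (weightPoly i.succ) (-1) - polyEval (weightPoly i.castSucc) 1| ≤ 100 := by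
    have h5 := polyEvalInt_cast (weightPoly i.succ) (-1)
    have h6 := polyEvalInt_cast (weightPoly i.castSucc) 1
    push_cast at h5 h6
    rw [← h5, ← h6]
    exact_mod_cast weightPoly_step i
  rw [weightRatio, weightRatio, h1, h2, ← sub_mul, abs_mul,
    abs_of_pos (a := _ ^ (_ : ℝ)) (by positivity)]
  calc _ ≤ (100 : ℝ) * 16 := by gcongr
    _ = 1600 := by norm_num

/-- Errors add up along the chain from `u = 1`: at worst `100 + 3 * 1600 + 4 * 20000 = 84900`. -/
theorem abs_weightRatio_sub_scale_le (i : Fin 4) {x : ℝ} (hx : x ∈ Set.Icc (-1 : ℝ) 1) :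
    |weightRatio i x - 10 ^ 20| ≤ 100000 := by
  have h1 : (1 : ℝ) ∈ Set.Icc (-1 : ℝ) 1 := ⟨by norm_num, le_rfl⟩
  have e0 := abs_le.1 abs_weightRatio_zero_sub_le
  have e1 := abs_le.1 (abs_weightRatio_step 0)
  have e2 := abs_le.1 (abs_weightRatio_step 1)
  have e3 := abs_le.1 (abs_weightRatio_step 2)
  have f0 := abs_le.1 (abs_weightRatio_sub_le 0 h1)
  have f1 := abs_le.1 (abs_weightRatio_sub_le 1 h1)
  have f2 := abs_le.1 (abs_weightRatio_sub_le 2 h1)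
  have hi := abs_le.1 (abs_weightRatio_sub_le i hx)
  simp only [Fin.reduceSucc, Fin.reduceCastSucc] at e1 e2 e3
  rw [abs_le]
  fin_cases i <;> simp only [Fin.zero_eta, Fin.mk_one, Fin.reduceFinMk] at * <;>
    constructor <;> linarith [e0.1, e0.2, e1.1, e1.2, e2.1, e2.2, e3.1, e3.2, f0.1, f0.2, f1.1,
      f1.2, f2.1, f2.2, hi.1, hi.2]

theorem abs_weightPoly_sub_le (i : Fin 4) {x : ℝ} (hx : x ∈ Set.Icc (-1 : ℝ) 1) :
    |polyEval (weightPoly i) x - 10 ^ 20 * ((nodeInt i + x) / 2) ^ (-(2 * dimApprox))| ≤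
      100000 := by
  have hn := (nodeInt_bounds i).1
  have hb : 1 ≤ (nodeInt i + x) / 2 := by linarith [hx.1]
  have hW : 0 < ((nodeInt i + x) / 2) ^ (-(2 * dimApprox)) := by positivity
  have hW1 : ((nodeInt i + x) / 2) ^ (-(2 * dimApprox)) ≤ 1 :=
    Real.rpow_le_one_of_one_le_of_nonpos hb (by rw [dimApprox]; norm_num)
  have h : polyEval (weightPoly i) x - 10 ^ 20 * ((nodeInt i + x) / 2) ^ (-(2 * dimApprox)) =
      (weightRatio i x - 10 ^ 20) * ((nodeInt i + x) / 2) ^ (-(2 * dimApprox)) := by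
    rw [weightRatio, sub_mul, mul_assoc, ← Real.rpow_add (by linarith), add_neg_cancel,
      Real.rpow_zero, mul_one]
  rw [h, abs_mul, abs_of_pos hW]
  exact (mul_le_of_le_one_right (abs_nonneg _) hW1).trans (abs_weightRatio_sub_scale_le i hx)

/-! ### The approximate eigenfunction equation -/

/-- The approximate eigenfunction of the transfer operator. -/
noncomputable def eigFun (x : ℝ) : ℝ := polyEval eigPoly (2 * x - 1)

theorem abs_two_mul_sub_one_le {x : ℝ} (hx : x ∈ coreInterval) :
    |2 * x - 1| ≤ ((2 : ℕ) : ℝ) / (3 : ℕ) := by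
  rw [abs_le]; constructor <;> push_cast <;> linarith [hx.1, hx.2]

theorem abs_eigFun_sub_le {x : ℝ} (hx : x ∈ coreInterval) :
    |eigFun x - 10 ^ 20| ≤ 26 * 10 ^ 18 := by
  have h := abs_polyEval_le (by norm_num) (polyAdd eigPoly [-10 ^ 20]) (abs_two_mul_sub_one_le hx)
  rw [polyEval_add] at h
  have h2 : ((polyNorm 2 3 (polyAdd eigPoly [-10 ^ 20]) : ℕ) : ℝ) ≤ 26 * 10 ^ 18 := by
    exact_mod_cast norm_eigPoly_sub_le
  refine le_trans (le_of_eq ?_) (h.trans h2)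
  simp only [eigFun, polyEval]
  push_cast
  congr 1; ring

theorem abs_image_sub_le (i : Fin 4) {x : ℝ} (hx : x ∈ coreInterval) :
    |polyEval (weightPoly i) (2 * x - 1) * eigFun (1 / (digitVal i + x)) -
      10 ^ 20 * polyEval (imagePoly i) (2 * x - 1)| ≤ 30000 * 10 ^ 20 := by
  set t := 2 * x - 1
  have ht := abs_two_mul_sub_one_le hx
  have ht' := abs_le.1 ht
  push_cast at ht'
  have hn := (nodeInt_bounds i).1
  set v : ℝ := nodeInt i + t
  have hv : 0 < v := by simp only [v]; linarith [ht'.1]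
  have hvd : v = 2 * (digitVal i + x) := by
    simp only [v, t, nodeInt, digitVal]; push_cast; ring
  have hE := abs_polyEval_le (by norm_num) (polyAdd
      (polyMul (weightPoly i) (polyHom [4 - nodeInt i, -1] [nodeInt i, 1] eigPoly))
      (polyScale (-10 ^ 20) (polyMul (imagePoly i) (polyPow [nodeInt i, 1] 20)))) ht
  have hN := norm_imagePoly_le i
  set E := polyNorm 2 3 (polyAdd
      (polyMul (weightPoly i) (polyHom [4 - nodeInt i, -1] [nodeInt i, 1] eigPoly))
      (polyScale (-10 ^ 20) (polyMul (imagePoly i) (polyPow [nodeInt i, 1] 20))))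
  have hv' : polyEval [nodeInt i, 1] t = v := by simp [polyEval, v]
  have hu' : polyEval [4 - nodeInt i, -1] t = 4 - v := by simp [polyEval, v]; ring
  have hH : polyEval (polyHom [4 - nodeInt i, -1] [nodeInt i, 1] eigPoly) t =
      v ^ 20 * eigFun (1 / (digitVal i + x)) := by
    have h := polyEval_hom [4 - nodeInt i, -1] [nodeInt i, 1] eigPoly (x := t)
      (by rw [hv']; exact hv.ne')
    rw [hv', hu', show eigPoly.length = 20 + 1 from rfl, pow_succ, mul_right_comm] at h
    -- In the coordinate `2 * x - 1` the branch reads `t ↦ (4 - v) / v`.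
    have harg : (4 - v) / v = 2 * (1 / (digitVal i + x)) - 1 := by
      have : digitVal i + x ≠ 0 := by intro h0; rw [h0] at hvd; linarith
      rw [hvd]; field_simp; ring
    rw [mul_right_cancel₀ hv.ne' h, harg, eigFun]
  rw [polyEval_add, polyEval_mul, polyEval_scale, polyEval_mul, polyEval_pow, hv', hH] at hE
  have hE' : |polyEval (weightPoly i) t * eigFun (1 / (digitVal i + x)) -
      10 ^ 20 * polyEval (imagePoly i) t| * v ^ 20 ≤ E := by
    refine le_trans (le_of_eq ?_) hE
    generalize polyEval (weightPoly i) t = A, polyEval (imagePoly i) t = Q,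
      eigFun (1 / (digitVal i + x)) = g
    rw [← abs_of_pos (pow_pos hv 20), ← abs_mul, abs_of_pos (pow_pos hv 20)]
    refine congrArg abs ?_
    push_cast
    ring
  have hN' : (E : ℝ) * 3 ^ 20 ≤ 30000 * 10 ^ 20 * (3 * nodeInt i - 2) ^ 20 := by
    have h0 : (0 : ℤ) ≤ 3 * nodeInt i - 2 := by simp only [nodeInt]; omega
    have h1 : ((3 * nodeInt i - 2).toNat : ℝ) = 3 * nodeInt i - 2 := by
      have := Int.toNat_of_nonneg h0
      exact_mod_cast congrArg (Int.cast (R := ℝ)) this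
    rw [← h1]
    exact_mod_cast hN
  have hv3 : (3 * nodeInt i - 2 : ℝ) ^ 20 ≤ (3 * v) ^ 20 :=
    pow_le_pow_left₀ (by linarith) (by simp only [v]; linarith [ht'.1]) 20
  rw [mul_pow] at hv3
  refine le_of_mul_le_mul_right (hE'.trans ?_) (pow_pos hv 20)
  refine le_of_mul_le_mul_right (hN'.trans ?_) (by positivity : (0 : ℝ) < 3 ^ 20)
  linarith

theorem abs_transferOp_eigFun_sub_le {x : ℝ} (hx : x ∈ coreInterval) :
    |transferOp dimApprox eigFun x - eigFun x| ≤ 1 / 10 ^ 13 * eigFun x := by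
  have ht := abs_two_mul_sub_one_le hx
  have ht' := abs_le.1 ht
  push_cast at ht'
  set t := 2 * x - 1
  have hf := abs_le.1 (abs_eigFun_sub_le hx)
  -- `156000` is `100000 * 1.26` from the weight plus `30000` from the image polynomial. The total
  -- `4 * 156000 + 400000` is below `10⁻¹³ * 74 * 10^18`.
  have hterm : ∀ i : Fin 4, |(1 / (digitVal i + x) ^ 2) ^ dimApprox *
      eigFun (1 / (digitVal i + x)) - polyEval (imagePoly i) t| ≤ 156000 := by
    intro i
    have hn := (nodeInt_bounds i).1
    have hd : (nodeInt i + t) / 2 = digitVal i + x := by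
      simp only [t, nodeInt, digitVal]; push_cast; ring
    have h1 := abs_weightPoly_sub_le i (x := t) ⟨by linarith [ht'.1], by linarith [ht'.2]⟩
    have h2 := abs_image_sub_le i hx
    have h3 := abs_le.1 (abs_eigFun_sub_le (branch_mem_coreInterval i hx))
    have hpos : 0 < digitVal i + x := by
      have := one_le_digitVal i
      have := coreInterval_nonneg hx
      linarith
    have hW : (1 / (digitVal i + x) ^ 2) ^ dimApprox =
        (digitVal i + x) ^ (-(2 * dimApprox)) := by
      rw [one_div, Real.inv_rpow (by positivity), ← Real.rpow_natCast, ← Real.rpow_mul hpos.le,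
        ← Real.rpow_neg hpos.le]
      norm_num
    rw [hd, ← hW] at h1
    set W := (1 / (digitVal i + x) ^ 2) ^ dimApprox
    set g := eigFun (1 / (digitVal i + x))
    set A := polyEval (weightPoly i) t
    set Q := polyEval (imagePoly i) t
    have hg : |g| ≤ 126 * 10 ^ 18 := by rw [abs_le]; constructor <;> linarith [h3.1, h3.2]
    have h4 : |(A - 10 ^ 20 * W) * g| ≤ 100000 * (126 * 10 ^ 18) := by
      rw [abs_mul]; gcongr
    have h5 := abs_le.1 h4
    have h6 := abs_le.1 h2
    rw [abs_le]
    constructor <;> nlinarith [h5.1, h5.2, h6.1, h6.2]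
  have hsum : |polyEval (imagePoly 0) t + polyEval (imagePoly 1) t + (polyEval (imagePoly 2) t +
      polyEval (imagePoly 3) t) - eigFun x| ≤ 400000 := by
    have h := abs_polyEval_le (by norm_num) (polyAdd (polyAdd (polyAdd (imagePoly 0) (imagePoly 1))
      (polyAdd (imagePoly 2) (imagePoly 3))) (polyScale (-1) eigPoly)) ht
    simp only [polyEval_add, polyEval_scale] at h
    have h2 := h.trans (Nat.cast_le.2 norm_sum_imagePoly_sub_le)
    push_cast at h2
    refine le_trans (le_of_eq ?_) h2
    rw [eigFun]
    refine congrArg abs ?_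
    ring
  have t0 := abs_le.1 (hterm 0)
  have t1 := abs_le.1 (hterm 1)
  have t2 := abs_le.1 (hterm 2)
  have t3 := abs_le.1 (hterm 3)
  have hs := abs_le.1 hsum
  rw [transferOp, Fin.sum_univ_four, abs_le]
  constructor <;> linarith [t0.1, t0.2, t1.1, t1.2, t2.1, t2.2, t3.1, t3.2, hs.1, hs.2, hf.1, hf.2]

theorem le_eigFun {x : ℝ} (hx : x ∈ coreInterval) : 1 ≤ eigFun x := by
  linarith [(abs_le.1 (abs_eigFun_sub_le hx)).1]

theorem eigFun_le {x : ℝ} (hx : x ∈ coreInterval) : eigFun x ≤ 126 * 10 ^ 18 := by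
  linarith [(abs_le.1 (abs_eigFun_sub_le hx)).2]

/-! ### Shifting the exponent and conclusion -/

theorem one_add_le_rpow {δ : ℝ} (hδ : 0 ≤ δ) : 1 + 11 / 36 * δ ≤ (36 / 25 : ℝ) ^ δ := by
  have h1 := Real.one_sub_inv_le_log_of_pos (by norm_num : (0 : ℝ) < 36 / 25)
  have h2 : 11 / 36 ≤ Real.log (36 / 25) := by norm_num at h1 ⊢; linarith
  rw [Real.rpow_def_of_pos (by norm_num)]
  have h3 := Real.add_one_le_exp (Real.log (36 / 25) * δ)
  nlinarith

/-- Every branch derivative on `coreInterval` is at most `25/36`, so strict monotonicity in `s` is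
quantitative. -/
theorem transferOp_add_mul_le {s δ : ℝ} (hδ : 0 ≤ δ) {f : ℝ → ℝ}
    (hf : ∀ x ∈ coreInterval, 0 ≤ f x) {x : ℝ} (hx : x ∈ coreInterval) :
    transferOp (s + δ) f x * (36 / 25) ^ δ ≤ transferOp s f x := by
  rw [transferOp, transferOp, Finset.sum_mul]
  refine Finset.sum_le_sum fun i _ => ?_
  have h1 := one_le_digitVal i
  have h2 := hx.1
  have hb : 0 < 1 / (digitVal i + x) ^ 2 := by positivity
  have h4 : 1 / (digitVal i + x) ^ 2 * (36 / 25) ≤ 1 := by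
    rw [div_mul_eq_mul_div, div_le_one (by positivity)]; nlinarith
  have h3 : (1 / (digitVal i + x) ^ 2) ^ δ * (36 / 25) ^ δ ≤ 1 := by
    rw [← Real.mul_rpow hb.le (by norm_num)]
    exact Real.rpow_le_one (by positivity) h4 hδ
  have h5 := hf _ (branch_mem_coreInterval i hx)
  rw [Real.rpow_add hb]
  calc _ = (1 / (digitVal i + x) ^ 2) ^ s * f (1 / (digitVal i + x)) *
        ((1 / (digitVal i + x) ^ 2) ^ δ * (36 / 25) ^ δ) := by ring
    _ ≤ _ := mul_le_of_le_one_right (by positivity) h3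

theorem dimH_contFractSet_four_le_approx :
    dimH (contFractSet 4) ≤ ENNReal.ofReal (0.788945557483 + 1 / 10 ^ 12) := by
  refine dimH_contFractSet_four_le (by norm_num) one_pos (fun x hx => le_eigFun hx) fun x hx => ?_
  have hpos : ∀ x ∈ coreInterval, 0 ≤ eigFun x := fun x hx => by linarith [le_eigFun hx]
  have h1 := transferOp_add_mul_le (s := dimApprox) (δ := 846 / 10 ^ 15) (by norm_num) hpos hx
  have h2 := one_add_le_rpow (δ := 846 / 10 ^ 15) (by norm_num)
  have h3 := (abs_le.1 (abs_transferOp_eigFun_sub_le hx)).2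
  have h4 := hpos x hx
  rw [show dimApprox + 846 / 10 ^ 15 = 0.788945557483 + 1 / 10 ^ 12 by
    rw [dimApprox]; norm_num] at h1
  have h5 : (1 + 1 / 10 ^ 13 : ℝ) ≤ (36 / 25) ^ (846 / 10 ^ 15 : ℝ) :=
    le_trans (by norm_num) h2
  clear h2
  generalize (36 / 25 : ℝ) ^ (846 / 10 ^ 15 : ℝ) = P at h1 h5
  have h6 : 0 < P := lt_of_lt_of_le (by norm_num) h5
  refine le_of_mul_le_mul_right (h1.trans ?_) h6
  nlinarith

theorem approx_le_dimH_contFractSet_four :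
    ENNReal.ofReal (0.788945557483 - 1 / 10 ^ 12) ≤ dimH (contFractSet 4) := by
  refine le_dimH_contFractSet_four (by norm_num) one_pos (fun x hx => le_eigFun hx)
    (fun x hx => eigFun_le hx) fun x hx => ?_
  have hpos : ∀ x ∈ coreInterval, 0 ≤ eigFun x := fun x hx => by linarith [le_eigFun hx]
  have h1 := transferOp_add_mul_le (s := 0.788945557483 - 1 / 10 ^ 12) (δ := 1154 / 10 ^ 15)
    (by norm_num) hpos hx
  have h2 := one_add_le_rpow (δ := 1154 / 10 ^ 15) (by norm_num)
  have h3 := (abs_le.1 (abs_transferOp_eigFun_sub_le hx)).1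
  have h4 := hpos x hx
  rw [show (0.788945557483 - 1 / 10 ^ 12 : ℝ) + 1154 / 10 ^ 15 = dimApprox by
    rw [dimApprox]; norm_num] at h1
  -- A gain of `2 / 10 ^ 13` is asked for because `(1 - 10⁻¹³) * (1 + 10⁻¹³)` falls short of 1.
  have h5 : (1 + 2 / 10 ^ 13 : ℝ) ≤ (36 / 25) ^ (1154 / 10 ^ 15 : ℝ) :=
    le_trans (by norm_num) h2
  clear h2
  generalize (36 / 25 : ℝ) ^ (1154 / 10 ^ 15 : ℝ) = P at h1 h5
  have h7 : transferOp dimApprox eigFun x * (1 + 2 / 10 ^ 13) ≤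
      transferOp dimApprox eigFun x * P := by
    refine mul_le_mul_of_nonneg_left h5 ?_
    linarith
  linarith

theorem mainTheorem7 :
    dimH (contFractSet 4) ≠ ⊤ ∧
    (dimH (contFractSet 4)).toReal ∈
      Set.Icc ((0.788945557483 : ℝ) - 1 / 10 ^ 12) ((0.788945557483 : ℝ) + 1 / 10 ^ 12) ∧
    (Real.sqrt 19 - 2) / 3 < (dimH (contFractSet 4)).toReal := by
  have hle := dimH_contFractSet_four_le_approx
  have hge := approx_le_dimH_contFractSet_four
  have htop : dimH (contFractSet 4) ≠ ⊤ := ne_top_of_le_ne_top ENNReal.ofReal_ne_top hle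
  have hle' := ENNReal.toReal_le_of_le_ofReal (by norm_num) hle
  have hge' := (ENNReal.ofReal_le_iff_le_toReal htop).1 hge
  refine ⟨htop, ⟨hge', hle'⟩, lt_of_lt_of_le ?_ hge'⟩
  -- `4.36² = 19.0096`, and `2.36 / 3 < 0.787`.
  have : Real.sqrt 19 < 4.36 := by
    rw [Real.sqrt_lt' (by norm_num)]; norm_num
  linarith
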